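/- Let $0 \le r \le 1$ and put $A = 1-\sqrt{r}$, $B = 1+\sqrt{r}$. Then $$\int_A^B \sqrt{(y^2-A^2)(B^2-y^2)}\,dy \;\ge\; r\pi\sqrt{1-r\left(1-\frac{64}{9\pi^2}\right)},$$ and equality holds when $r=0$ and when $r=1$. -/

import Mathlib

/-! With `s = √r`, a Landen-type substitution turns the integral into `2r ∫₀^π cos² a √(1 - r sin²
a) da`. Bounding the root below by its chord in `r` is too weak: the target is itself a root lying
above the resulting chord. A correction of order `r(1 - r)` is kept (`sqrt_one_sub_mul_ge`);
integrated against `cos²`, it exceeds what the target needs (`pi_mul_sqrt_le`). -/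

/-- A strengthening of the concavity bound for `r ↦ √(1 - r (1 - q ^ 2))` on `[0, 1]`. -/
theorem sqrt_one_sub_mul_ge {r q : ℝ} (hr0 : 0 ≤ r) (hr1 : r ≤ 1) (hq0 : 0 ≤ q) (hq1 : q ≤ 1) :
    1 - r + r * q + r * (1 - r) / 8 * (1 - q ^ 2) ^ 2 ≤ Real.sqrt (1 - r * (1 - q ^ 2)) := by
  apply Real.le_sqrt_of_sq_le
  obtain ⟨d, rfl⟩ : ∃ d, q = 1 - d := ⟨1 - q, by ring⟩
  have hd0 : 0 ≤ d := by linarith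
  have hd1 : d ≤ 1 := by linarith
  have ht0 : 0 ≤ r * (1 - r) := mul_nonneg hr0 (by linarith)
  have ht1 : r * (1 - r) ≤ 1 / 4 := by nlinarith [sq_nonneg (r - 1 / 2)]
  -- Chosen so that `1 - q ^ 2 = 2 * d * m`.
  set m : ℝ := 1 - d / 2 with hm
  have hmm : m ^ 2 ≤ 1 - 3 / 4 * d := by rw [hm]; nlinarith
  have hL : (1 - r * d) * m ^ 2 ≤ m ^ 2 := by nlinarith [mul_nonneg hr0 hd0, sq_nonneg m]
  have hdm : d ^ 2 * m ^ 2 ≤ d := by nlinarith [sq_nonneg d]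
  have hm1 : m ^ 2 ≤ 1 := by linarith
  have hm4 : d ^ 2 * m ^ 4 ≤ d := by nlinarith [sq_nonneg m, mul_nonneg hd0 (sq_nonneg m)]
  have hdm0 : 0 ≤ d ^ 2 * m ^ 4 := by positivity
  have hE : r * (1 - r) * (d ^ 2 * m ^ 4) ≤ 1 / 4 * d := by nlinarith
  have key : 0 ≤ 1 - (1 - r * d) * m ^ 2 - r * (1 - r) * (d ^ 2 * m ^ 4) / 4 := by linarith
  have := mul_nonneg (mul_nonneg ht0 (sq_nonneg d)) key
  have e : 1 - r * (1 - (1 - d) ^ 2)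
      - (1 - r + r * (1 - d) + r * (1 - r) / 8 * (1 - (1 - d) ^ 2) ^ 2) ^ 2
      = r * (1 - r) * d ^ 2 *
        (1 - (1 - r * d) * m ^ 2 - r * (1 - r) * (d ^ 2 * m ^ 4) / 4) := by
    rw [hm]; ring
  linarith

theorem integral_cos_sq_mul_abs_cos :
    ∫ a in (0 : ℝ)..Real.pi, Real.cos a ^ 2 * |Real.cos a| = 4 / 3 := by
  have hpi := Real.pi_pos
  have hF : ∀ x : ℝ, HasDerivAt (fun a => Real.sin a - Real.sin a ^ 3 / 3)
      (Real.cos x ^ 3) x := by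
    intro x
    have h := (Real.hasDerivAt_sin x).sub (((Real.hasDerivAt_sin x).pow 3).div_const 3)
    refine h.congr_deriv ?_
    simp only [Nat.cast_ofNat, Nat.add_one_sub_one]
    linear_combination -Real.cos x * Real.sin_sq_add_cos_sq x
  have hi : ∀ a b : ℝ, ∫ x in a..b, Real.cos x ^ 3
      = Real.sin b - Real.sin b ^ 3 / 3 - (Real.sin a - Real.sin a ^ 3 / 3) := fun a b =>
    intervalIntegral.integral_eq_sub_of_hasDerivAt (fun x _ => hF x)
      ((by fun_prop : Continuous fun x : ℝ => Real.cos x ^ 3).intervalIntegrable _ _)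
  have hc : Continuous fun a : ℝ => Real.cos a ^ 2 * |Real.cos a| := by fun_prop
  rw [← intervalIntegral.integral_add_adjacent_intervals (hc.intervalIntegrable 0 (Real.pi / 2))
    (hc.intervalIntegrable (Real.pi / 2) Real.pi)]
  have h1 : ∫ a in (0 : ℝ)..(Real.pi / 2), Real.cos a ^ 2 * |Real.cos a|
      = ∫ a in (0 : ℝ)..(Real.pi / 2), Real.cos a ^ 3 := by
    refine intervalIntegral.integral_congr fun a ha => ?_
    rw [Set.uIcc_of_le (by linarith)] at ha
    have : 0 ≤ Real.cos a := Real.cos_nonneg_of_mem_Icc ⟨by linarith [ha.1], ha.2⟩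
    simp only [abs_of_nonneg this]
    ring
  have h2 : ∫ a in (Real.pi / 2)..Real.pi, Real.cos a ^ 2 * |Real.cos a|
      = -∫ a in (Real.pi / 2)..Real.pi, Real.cos a ^ 3 := by
    rw [← intervalIntegral.integral_neg]
    refine intervalIntegral.integral_congr fun a ha => ?_
    rw [Set.uIcc_of_le (by linarith)] at ha
    have : Real.cos a ≤ 0 := Real.cos_nonpos_of_pi_div_two_le_of_le ha.1 (by linarith [ha.2])
    simp only [abs_of_nonpos this]
    ring
  rw [h1, h2, hi, hi]
  norm_num

theorem integral_cos_sq_mul_sin_pow_four :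
    ∫ a in (0 : ℝ)..Real.pi, Real.cos a ^ 2 * Real.sin a ^ 4 = Real.pi / 16 := by
  have hF : ∀ x : ℝ, HasDerivAt
      (fun a => a / 16 + Real.cos a * (Real.sin a ^ 5 / 6 - Real.sin a ^ 3 / 24 - Real.sin a / 16))
      (Real.cos x ^ 2 * Real.sin x ^ 4) x := by
    intro x
    have hs := Real.hasDerivAt_sin x
    have h := ((hasDerivAt_id x).div_const 16).add ((Real.hasDerivAt_cos x).mul
      ((((hs.pow 5).div_const 6).sub ((hs.pow 3).div_const 24)).sub (hs.div_const 16)))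
    refine h.congr_deriv ?_
    have hc : Real.cos x ^ 2 = 1 - Real.sin x ^ 2 := by
      linarith [Real.sin_sq_add_cos_sq x]
    simp only [Nat.cast_ofNat, Nat.add_one_sub_one, Pi.pow_apply, Pi.sub_apply]
    ring_nf
    rw [hc]
    ring
  rw [intervalIntegral.integral_eq_sub_of_hasDerivAt (fun x _ => hF x)
    ((by fun_prop : Continuous fun x : ℝ => Real.cos x ^ 2 * Real.sin x ^ 4).intervalIntegrable _ _)]
  norm_num

theorem integral_cos_sq_zero_pi : ∫ a in (0 : ℝ)..Real.pi, Real.cos a ^ 2 = Real.pi / 2 := by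
  rw [integral_cos_sq]
  norm_num

/-- The Landen-type substitution `y = s cos a + √(1 - s² sin² a)`. -/
theorem integral_sqrt_quartic_eq {s : ℝ} (hs0 : 0 ≤ s) (hs1 : s < 1) :
    ∫ y in (1 - s)..(1 + s), Real.sqrt ((y ^ 2 - (1 - s) ^ 2) * ((1 + s) ^ 2 - y ^ 2))
      = 2 * s ^ 2 * ∫ a in (0 : ℝ)..Real.pi,
          Real.cos a ^ 2 * Real.sqrt (1 - s ^ 2 * Real.sin a ^ 2) := by
  have hpi := Real.pi_pos
  set w : ℝ → ℝ := fun a => Real.sqrt (1 - s ^ 2 * Real.sin a ^ 2) with hw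
  have hpos : ∀ a, 0 < 1 - s ^ 2 * Real.sin a ^ 2 := fun a => by
    nlinarith [Real.sin_sq_le_one a, sq_nonneg s]
  have hw0 : ∀ a, 0 < w a := fun a => Real.sqrt_pos.2 (hpos a)
  have hw2 : ∀ a, w a ^ 2 = 1 - s ^ 2 * Real.sin a ^ 2 := fun a => Real.sq_sqrt (hpos a).le
  have hwc : Continuous w := by fun_prop
  have hwd : ∀ a, HasDerivAt w (-(s ^ 2 * Real.sin a * Real.cos a / w a)) a := by
    intro a
    have h := ((((Real.hasDerivAt_sin a).pow 2).const_mul (s ^ 2)).const_sub 1).sqrt (hpos a).ne'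
    refine h.congr_deriv ?_
    have := (hw0 a).ne'
    change _ / (2 * w a) = _
    simp only [Nat.cast_ofNat, Nat.add_one_sub_one, pow_one]
    field_simp
  set f : ℝ → ℝ := fun a => s * Real.cos a + w a with hf
  set f' : ℝ → ℝ := fun a => -(s * Real.sin a * f a / w a) with hf'
  have hfc : Continuous f := by fun_prop
  have hfd : ∀ a, HasDerivAt f (f' a) a := by
    intro a
    refine (((Real.hasDerivAt_cos a).const_mul s).add (hwd a)).congr_deriv ?_
    have := (hw0 a).ne'
    simp only [hf', hf]
    field_simp
    ring
  have hfc' : Continuous f' := by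
    have := fun a => (hw0 a).ne'
    exact (((continuous_const.mul Real.continuous_sin).mul hfc).div hwc this).neg
  have hf0 : ∀ a, 0 ≤ f a := by
    intro a
    have h1 : |s * Real.cos a| ≤ w a := by
      apply Real.le_sqrt_of_sq_le
      rw [sq_abs]
      nlinarith [Real.sin_sq_add_cos_sq a]
    have := (abs_le.1 h1).1
    simp only [hf]
    linarith
  set g : ℝ → ℝ := fun y => Real.sqrt ((y ^ 2 - (1 - s) ^ 2) * ((1 + s) ^ 2 - y ^ 2)) with hg
  have hgc : Continuous g := by fun_prop
  -- The limits are reversed because `f` runs from `1 + s` down to `1 - s`.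
  have hsub := intervalIntegral.integral_comp_mul_deriv (a := Real.pi) (b := 0)
    (fun x _ => hfd x) hfc'.continuousOn hgc
  have e0 : f 0 = 1 + s := by simp [hf, hw]; ring
  have e1 : f Real.pi = 1 - s := by simp [hf, hw]; ring
  rw [e0, e1, intervalIntegral.integral_symm] at hsub
  rw [← hsub, ← intervalIntegral.integral_neg, ← intervalIntegral.integral_const_mul]
  have hgf : ∀ a ∈ Set.uIcc 0 Real.pi, g (f a) = 2 * s * f a * Real.sin a := by
    intro a ha
    rw [Set.uIcc_of_le hpi.le] at ha
    have hsin := Real.sin_nonneg_of_mem_Icc ha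
    have := hf0 a
    have hcos := Real.sin_sq_add_cos_sq a
    -- In the triangle with sides `1`, `s`, `f a` and angle `a` opposite `1`, `-X` is the cosine of
    -- the angle opposite `f a`; `h1` and `h2` are the cosine and sine rules.
    set X := w a * Real.cos a - s * Real.sin a ^ 2 with hX
    have h1 : f a ^ 2 = 1 + s ^ 2 + 2 * s * X := by
      simp only [hf, hX]
      linear_combination hw2 a + s ^ 2 * hcos
    have h2 : 1 - X ^ 2 = f a ^ 2 * Real.sin a ^ 2 := by
      simp only [hf, hX]
      linear_combination -hw2 a - (s ^ 2 * Real.sin a ^ 2 + w a ^ 2) * hcos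
    have h3 : (f a ^ 2 - (1 - s) ^ 2) * ((1 + s) ^ 2 - f a ^ 2)
        = (2 * s * f a * Real.sin a) ^ 2 := by
      rw [h1]
      linear_combination 4 * s ^ 2 * h2
    simp only [hg]
    rw [h3, Real.sqrt_sq (by positivity)]
  -- The transformed integrand and the desired one differ by the derivative of `G`, which vanishes
  -- at both ends.
  set G : ℝ → ℝ := fun a => 4 / 3 * s ^ 3 * Real.sin a ^ 3
    - 2 * s ^ 2 * (Real.sin a * Real.cos a * w a) with hG
  set G' : ℝ → ℝ := fun a => -(2 * s * f a * Real.sin a * f' a)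
    - 2 * s ^ 2 * (Real.cos a ^ 2 * w a) with hG'
  have hGd : ∀ a, HasDerivAt G (G' a) a := by
    intro a
    have hs := Real.hasDerivAt_sin a
    have h := ((hs.pow 3).const_mul (4 / 3 * s ^ 3)).sub
      (((hs.mul (Real.hasDerivAt_cos a)).mul (hwd a)).const_mul (2 * s ^ 2))
    refine h.congr_deriv ?_
    have h0 := (hw0 a).ne'
    simp only [hG', hf', hf, Nat.cast_ofNat, Nat.add_one_sub_one, Pi.mul_apply]
    field_simp
    ring_nf
  have hGi := intervalIntegral.integral_eq_sub_of_hasDerivAt (a := 0) (b := Real.pi)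
    (fun x _ => hGd x) ((by fun_prop : Continuous G').intervalIntegrable _ _)
  have hG0 : G Real.pi - G 0 = 0 := by simp [hG]
  rw [hG0, hG', intervalIntegral.integral_sub
    ((by fun_prop : Continuous _).intervalIntegrable _ _)
    ((by fun_prop : Continuous _).intervalIntegrable _ _), sub_eq_zero] at hGi
  rw [← hGi]
  refine intervalIntegral.integral_congr fun a ha => ?_
  simp only [Function.comp_apply, hgf a ha]

theorem integral_cos_sq_mul_sqrt_ge {r : ℝ} (hr0 : 0 ≤ r) (hr1 : r ≤ 1) :
    (1 - r) * (Real.pi / 2) + r * (4 / 3) + r * (1 - r) / 8 * (Real.pi / 16)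
      ≤ ∫ a in (0 : ℝ)..Real.pi, Real.cos a ^ 2 * Real.sqrt (1 - r * Real.sin a ^ 2) := by
  have hc1 : Continuous fun a : ℝ => (1 - r) * Real.cos a ^ 2 := by fun_prop
  have hc2 : Continuous fun a : ℝ => r * (Real.cos a ^ 2 * |Real.cos a|) := by fun_prop
  have hc3 : Continuous fun a : ℝ => r * (1 - r) / 8 * (Real.cos a ^ 2 * Real.sin a ^ 4) := by
    fun_prop
  have hc4 : Continuous fun a : ℝ => Real.cos a ^ 2 * Real.sqrt (1 - r * Real.sin a ^ 2) := by
    fun_prop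
  rw [← integral_cos_sq_zero_pi, ← integral_cos_sq_mul_abs_cos, ← integral_cos_sq_mul_sin_pow_four,
    ← intervalIntegral.integral_const_mul, ← intervalIntegral.integral_const_mul,
    ← intervalIntegral.integral_const_mul,
    ← intervalIntegral.integral_add (hc1.intervalIntegrable _ _) (hc2.intervalIntegrable _ _),
    ← intervalIntegral.integral_add ((hc1.fun_add hc2).intervalIntegrable _ _)
      (hc3.intervalIntegrable _ _)]
  refine intervalIntegral.integral_mono_on Real.pi_pos.le
    (((hc1.add hc2).add hc3).intervalIntegrable _ _) (hc4.intervalIntegrable _ _) fun a _ => ?_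
  have h := sqrt_one_sub_mul_ge hr0 hr1 (abs_nonneg (Real.cos a)) (Real.abs_cos_le_one a)
  rw [sq_abs, ← Real.sin_sq] at h
  have := mul_le_mul_of_nonneg_left h (sq_nonneg (Real.cos a))
  linarith

/-- With `k = 8 / (3π)`, the squared root exceeds the squared chord `1 - r(1 - k)` by exactly `r(1 -
r)(1 - k)²`, and the correction supplies at least `r(1 - r)(1 - r(1 - k)) / 32`. -/
theorem pi_mul_sqrt_le {r : ℝ} (hr0 : 0 ≤ r) (hr1 : r ≤ 1) :
    Real.pi * Real.sqrt (1 - r * (1 - 64 / (9 * Real.pi ^ 2)))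
      ≤ 2 * ((1 - r) * (Real.pi / 2) + r * (4 / 3) + r * (1 - r) / 8 * (Real.pi / 16)) := by
  have hpi := Real.pi_pos
  obtain ⟨k, hk⟩ : ∃ k, k = 8 / (3 * Real.pi) := ⟨_, rfl⟩
  have hk1 : 64 / (9 * Real.pi ^ 2) = k ^ 2 := by rw [hk]; field_simp; norm_num
  have hk2 : (1 - r) * (Real.pi / 2) + r * (4 / 3) + r * (1 - r) / 8 * (Real.pi / 16)
      = Real.pi / 2 * (1 - r * (1 - k) + r * (1 - r) / 64) := by
    rw [hk]; field_simp; ring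
  have hk3 : 0.848 ≤ k := by
    rw [hk, le_div_iff₀ (by positivity)]
    linarith [Real.pi_lt_d4]
  have hk4 : k ≤ 0.85 := by
    rw [hk, div_le_iff₀ (by positivity)]
    linarith [Real.pi_gt_d4]
  rw [hk1, hk2, ← mul_assoc, mul_div_cancel₀ _ (two_ne_zero' ℝ)]
  refine mul_le_mul_of_nonneg_left ?_ hpi.le
  have ht0 : 0 ≤ r * (1 - r) := mul_nonneg hr0 (by linarith)
  have hp : 0.848 ≤ 1 - r * (1 - k) := by nlinarith
  rw [Real.sqrt_le_left (by linarith)]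
  have hu : 0 ≤ (1 - r * (1 - k)) / 32 - (1 - k) ^ 2 := by nlinarith
  have := mul_nonneg ht0 hu
  nlinarith [sq_nonneg (r * (1 - r) / 64)]

/-- Treated apart: at `s = 1` the root in the substitution becomes `|cos a|`, not differentiable at
`π / 2`. -/
theorem integral_sqrt_quartic_eq_of_one :
    ∫ y in (0 : ℝ)..2, Real.sqrt ((y ^ 2 - 0 ^ 2) * (2 ^ 2 - y ^ 2)) = 8 / 3 := by
  have hcongr : ∫ y in (0 : ℝ)..2, Real.sqrt ((y ^ 2 - 0 ^ 2) * (2 ^ 2 - y ^ 2))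
      = ∫ y in (0 : ℝ)..2, y * Real.sqrt (4 - y ^ 2) := by
    refine intervalIntegral.integral_congr fun y hy => ?_
    rw [Set.uIcc_of_le (by norm_num)] at hy
    rw [Real.sqrt_mul (by nlinarith [hy.1]), zero_pow two_ne_zero, sub_zero, Real.sqrt_sq hy.1]
    norm_num
  have hd : ∀ y ∈ Set.Ioo (0 : ℝ) 2,
      HasDerivAt (fun y : ℝ => -((4 - y ^ 2) * Real.sqrt (4 - y ^ 2)) / 3)
        (y * Real.sqrt (4 - y ^ 2)) y := by
    intro y hy
    have hpos : 0 < 4 - y ^ 2 := by nlinarith [hy.1, hy.2]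
    have h0 := (((hasDerivAt_id y).pow 2).const_sub 4)
    have h := ((h0.mul (h0.sqrt hpos.ne')).neg).div_const 3
    refine h.congr_deriv ?_
    have hs := Real.sq_sqrt hpos.le
    have hs0 := (Real.sqrt_pos.2 hpos).ne'
    simp only [Nat.cast_ofNat, Nat.add_one_sub_one, id_eq, Pi.pow_apply, pow_one, mul_one]
    field_simp
    linear_combination -y * hs
  rw [hcongr, intervalIntegral.integral_eq_sub_of_hasDerivAt_of_le (by norm_num)
    (by fun_prop) hd ((by fun_prop : Continuous _).intervalIntegrable _ _)]
  have : Real.sqrt 4 = 2 := by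
    rw [show (4 : ℝ) = 2 ^ 2 by norm_num, Real.sqrt_sq (by norm_num)]
  norm_num [this]

theorem mainTheorem8 (r : ℝ) (hr0 : 0 ≤ r) (hr1 : r ≤ 1) (A B : ℝ)
    (hA : A = 1 - Real.sqrt r) (hB : B = 1 + Real.sqrt r) :
    (∫ y in A..B, Real.sqrt ((y ^ 2 - A ^ 2) * (B ^ 2 - y ^ 2)))
        ≥ r * Real.pi * Real.sqrt (1 - r * (1 - 64 / (9 * Real.pi ^ 2))) ∧
      ((r = 0 ∨ r = 1) →
        (∫ y in A..B, Real.sqrt ((y ^ 2 - A ^ 2) * (B ^ 2 - y ^ 2)))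
          = r * Real.pi * Real.sqrt (1 - r * (1 - 64 / (9 * Real.pi ^ 2)))) := by
  have hone : r = 1 → (∫ y in A..B, Real.sqrt ((y ^ 2 - A ^ 2) * (B ^ 2 - y ^ 2)))
      = r * Real.pi * Real.sqrt (1 - r * (1 - 64 / (9 * Real.pi ^ 2))) := by
    rintro rfl
    have hpi := Real.pi_pos
    have hA0 : A = 0 := by simp [hA]
    have hB2 : B = 2 := by rw [hB, Real.sqrt_one]; norm_num
    rw [hA0, hB2, integral_sqrt_quartic_eq_of_one,
      show 1 - 1 * (1 - 64 / (9 * Real.pi ^ 2)) = (8 / (3 * Real.pi)) ^ 2 by field_simp; norm_num,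
      Real.sqrt_sq (by positivity)]
    field_simp
  refine ⟨?_, ?_⟩
  · rcases hr1.lt_or_eq with hlt | heq
    · have hs : Real.sqrt r ^ 2 = r := Real.sq_sqrt hr0
      have hs1 : Real.sqrt r < 1 := by rwa [Real.sqrt_lt' one_pos, one_pow]
      rw [hA, hB, integral_sqrt_quartic_eq (Real.sqrt_nonneg r) hs1, hs, ge_iff_le, mul_assoc,
        mul_comm 2 r, mul_assoc]
      refine mul_le_mul_of_nonneg_left ((pi_mul_sqrt_le hr0 hr1).trans ?_) hr0
      exact mul_le_mul_of_nonneg_left (integral_cos_sq_mul_sqrt_ge hr0 hr1) zero_le_two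
    · exact (hone heq).ge
  · rintro (rfl | h)
    · simp [hA, hB]
    · exact hone h
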